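/- For a small category $O$ let $\widehat O=[O^{op},\mathrm{Set}]$, let $M(O)=\coprod_n O^n$ be the free strict monoidal category on $O$ and $sM(O)$ the free symmetric strict monoidal category on $O$: its objects are words in $O$, and a morphism $\vec p\to\vec q$ is a pair $(\sigma,\vec v)$ of a bijection $\sigma$ of positions and morphisms $v_i:p_i\to q_{\sigma(i)}$ in $O$. Let $\mathbf u:M(O)\to sM(O)$ be the identity-on-objects embedding and $\iota_O:sM(O)\to\widehat O$, $(o_1,\dots,o_n)\mapsto y(o_1)+\dots+y(o_n)$, the sum functor ($y$ the Yoneda embedding). For $X\in\widehat O$ put $X^{\vec p}=\prod_i X(p_i)$, which is contravariant in $\vec p\in sM(O)$. Let $\mathrm{Gph}_{2fi}(M)\to\mathrm{Cat}$ be the fibration whose objects over $O$ are the functors $A: O^{op}\times M(O)\to\mathrm{Set}$, written $A(o;\vec p)$ (equivalently, two-sided discrete fibrations from $O$ to $M(O)$), a morphism $A\to B$ over $U:O\to Q$ being a natural family of maps $A(o;\vec p)\to B(Uo;M(U)\vec p)$. Let $\mathcal S$ be the symmetrization monad on it, $$\mathcal S(A)(o;\vec q)=\int^{\vec p\in M(O)}A(o;\vec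 p)\times sM(O)(\vec p,\vec q),$$ with unit $a\mapsto[a,1]$ and multiplication $[[a,s],t]\mapsto[a,ts]$. Let $\mathrm{End}(\mathrm{DFib})\to\mathrm{Cat}$ be the fibration whose objects over $O$ are the endofunctors of $\widehat O\simeq\mathrm{DFib}(O)$, a morphism $P\to R$ over $U$ being a natural transformation $PU^*\to U^*R$. Let $\ddot{\mathbf r}:\mathrm{Gph}_{2fi}(M)^{\mathcal S}\to\mathrm{End}(\mathrm{DFib})$, over $\mathrm{Cat}$, be the representation of the Eilenberg–Moore fibration of $\mathcal S$-algebras: with $(A\star X)(o)=\int^{\vec p\in M(O)}A(o;\vec p)\times X^{\vec p}$, it sends an algebra $(A,\phi)$ to the functor that takes $X$ to the coequalizer of the two maps $\mathcal S(A)\star X\rightrightarrows A\star X$ given by $\phi\star X$ and by $[[a,(\sigma,\vec v)],\vec x]\mapsto[a,(X(v_i)(x_{\sigma(i)}))_i]$. Then: 1. For every small category $O$, the functor $[sM(O),\widehat O]\to(\mathrm{Gph}_{2fi}(M)^{\mathcal S})_O$ sending $F$ to $F\mathbf u$ with the action $[a,s]\mapsto F(s)(a)$ is an equivalence of categories, and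 its composite with $\ddot{\mathbf r}$ is naturally isomorphic, in the fibre of $\mathrm{End}(\mathrm{DFib})$ over $O$, to the left Kan extension functor $\mathrm{Lan}_{\iota_O}:[sM(O),\widehat O]\to[\widehat O,\widehat O]$ along the sum functor. 2. An object $(O,P:\widehat O\to\widehat O)$ of $\mathrm{End}(\mathrm{DFib})$ is in the essential image of $\ddot{\mathbf r}$ if and only if $P$ is analytic in the sense of Fiore–Gambino–Hyland–Winskel, i.e. $P$ is a left Kan extension along $\iota_O: sM(O)\to\widehat O$ of some functor $F:sM(O)\to\widehat O$. -/

import Mathlib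

open CategoryTheory Opposite

universe u

namespace Symmetrization

/-! ### Coends of the form `∫^j F j × G j` -/

section Coend

variable {J : Type u} [Category.{u} J]

/-- The relation identifying `(F v a, b)` with `(a, G v b)` for `v : i ⟶ j`,
`a ∈ F i`, `b ∈ G j`. -/
inductive CoendRel (F : J ⥤ Type u) (G : Jᵒᵖ ⥤ Type u) :
    (Σ j : J, F.obj j × G.obj (op j)) → (Σ j : J, F.obj j × G.obj (op j)) → Prop
  | intro {i j : J} (v : i ⟶ j) (a : F.obj i) (b : G.obj (op j)) :
      CoendRel F G ⟨j, F.map v a, b⟩ ⟨i, a, G.map v.op b⟩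

/-- The coend `∫^j F j × G j` of a covariant and a contravariant set-valued functor. -/
def Coend (F : J ⥤ Type u) (G : Jᵒᵖ ⥤ Type u) : Type u :=
  Quot (CoendRel F G)

namespace Coend

variable {F : J ⥤ Type u} {G : Jᵒᵖ ⥤ Type u}

/-- The class of `(a, b)` in the coend. -/
def mk (j : J) (a : F.obj j) (b : G.obj (op j)) : Coend F G :=
  Quot.mk _ ⟨j, a, b⟩

theorem condition {i j : J} (v : i ⟶ j) (a : F.obj i) (b : G.obj (op j)) :
    (mk j (F.map v a) b : Coend F G) = mk i a (G.map v.op b) :=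
  Quot.sound (CoendRel.intro v a b)

/-- The universal property of the coend. -/
def lift {T : Type u} (f : ∀ j : J, F.obj j → G.obj (op j) → T)
    (hf : ∀ {i j : J} (v : i ⟶ j) (a : F.obj i) (b : G.obj (op j)),
      f j (F.map v a) b = f i a (G.map v.op b)) :
    Coend F G → T :=
  Quot.lift (fun x => f x.1 x.2.1 x.2.2) (by rintro _ _ ⟨v, a, b⟩; exact hf v a b)

@[simp]
theorem lift_mk {T : Type u} (f : ∀ j : J, F.obj j → G.obj (op j) → T)
    (hf : ∀ {i j : J} (v : i ⟶ j) (a : F.obj i) (b : G.obj (op j)),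
      f j (F.map v a) b = f i a (G.map v.op b)) (j : J) (a : F.obj j) (b : G.obj (op j)) :
    lift f hf (mk j a b) = f j a b :=
  rfl

theorem ind {motive : Coend F G → Prop}
    (h : ∀ (j : J) (a : F.obj j) (b : G.obj (op j)), motive (mk j a b)) (x : Coend F G) :
    motive x :=
  Quot.ind (fun ⟨j, a, b⟩ => h j a b) x

end Coend

end Coend

/-! ### Free strict monoidal and free symmetric strict monoidal categories -/

section Words

/-- The underlying category of the free strict monoidal category on `O`, i.e. the disjoint
union of the categories `Oⁿ`: a morphism of words of the same length is a family of morphisms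
between the letters, and there are no morphisms between words of different lengths. -/
abbrev Words (O : Type u) : Type u := Σ n : ℕ, (Fin n → O)

/-- Words in `O`, as objects of the free symmetric strict monoidal category on `O`. -/
structure SymWords (O : Type u) : Type u where
  len : ℕ
  letter : Fin len → O

/-- A morphism `(σ, v) : p ⟶ q` of the free symmetric strict monoidal category: a bijection `σ`
of the positions and morphisms `v i : p i ⟶ q (σ i)`. -/
@[ext]
structure SymWords.Hom {O : Type u} [Category.{u} O] (p q : SymWords O) : Type u where
  perm : Fin p.len ≃ Fin q.len
  map : ∀ i, p.letter i ⟶ q.letter (perm i)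

instance {O : Type u} [Category.{u} O] : Category.{u} (SymWords O) where
  Hom p q := SymWords.Hom p q
  id p := ⟨Equiv.refl _, fun i => 𝟙 (p.letter i)⟩
  comp f g := ⟨f.perm.trans g.perm, fun i => f.map i ≫ g.map (f.perm i)⟩
  id_comp _ := SymWords.Hom.ext rfl (heq_of_eq (funext fun _ => Category.id_comp _))
  comp_id _ := SymWords.Hom.ext rfl (heq_of_eq (funext fun _ => Category.comp_id _))
  assoc _ _ _ := SymWords.Hom.ext rfl (heq_of_eq (funext fun _ => Category.assoc _ _ _))

/-- The embedding of the free strict monoidal category into the free symmetric strict monoidal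
category; it is the identity on words. -/
def toSym (O : Type u) [Category.{u} O] : Words O ⥤ SymWords O :=
  Sigma.desc fun n =>
    { obj := fun x => ⟨n, x⟩
      map := fun v => ⟨Equiv.refl _, v⟩
      map_id := fun _ => rfl
      map_comp := fun _ _ => rfl }

variable {O Q : Type u} [Category.{u} O] [Category.{u} Q]

/-- Functoriality of the free strict monoidal category. -/
def wordsMap (U : O ⥤ Q) : Words O ⥤ Words Q :=
  Sigma.desc fun n =>
    { obj := fun x => ⟨n, fun i => U.obj (x i)⟩
      map := fun v => Sigma.SigmaHom.mk fun i => U.map (v i)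
      map_id := fun x => congrArg Sigma.SigmaHom.mk (funext fun i => U.map_id (x i))
      map_comp := fun v w => congrArg Sigma.SigmaHom.mk (funext fun i => U.map_comp (v i) (w i)) }

/-- Functoriality of the free symmetric strict monoidal category. -/
def symWordsMap (U : O ⥤ Q) : SymWords O ⥤ SymWords Q where
  obj p := ⟨p.len, fun i => U.obj (p.letter i)⟩
  map f := ⟨f.perm, fun i => U.map (f.map i)⟩
  map_id p := SymWords.Hom.ext rfl (heq_of_eq (funext fun i => U.map_id (p.letter i)))
  map_comp f g := SymWords.Hom.ext rfl
    (heq_of_eq (funext fun i => U.map_comp (f.map i) (g.map (f.perm i))))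

theorem toSym_naturality (U : O ⥤ Q) {p q : Words O} (v : p ⟶ q) :
    (symWordsMap U).map ((toSym O).map v) = (toSym Q).map ((wordsMap U).map v) := by
  obtain ⟨v⟩ := v
  rfl

/-- On morphisms, `wordsMap` preserves identity functors. -/
theorem wordsMap_id_map {p q : Words O} (v : p ⟶ q) : (wordsMap (𝟭 O)).map v = v := by
  obtain ⟨v⟩ := v
  rfl

/-- On morphisms, `wordsMap` preserves composition of functors. -/
theorem wordsMap_comp_map {R : Type u} [Category.{u} R] (U : O ⥤ Q) (V : Q ⥤ R)
    {p q : Words O} (v : p ⟶ q) :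
    (wordsMap (U ⋙ V)).map v = (wordsMap V).map ((wordsMap U).map v) := by
  obtain ⟨v⟩ := v
  rfl

end Words

/-! ### Presheaves, powers and sums of representables -/

section Presheaves

/-- The category of presheaves on `O` (equivalently, of discrete fibrations over `O`). -/
abbrev Psh (O : Type u) [Category.{u} O] : Type (u + 1) := Oᵒᵖ ⥤ Type u

variable {O Q : Type u} [Category.{u} O] [Category.{u} Q]

/-- Reindexing of presheaves along a functor. -/
abbrev pull (U : O ⥤ Q) : Psh Q ⥤ Psh O := (Functor.whiskeringLeft _ _ _).obj U.op

/-- The functor `p ↦ X^p = ∏ i, X (p i)`, contravariant in the word `p`; a morphism `(σ, v)`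
sends `x` to the family with `i`-th entry `X (v i) (x (σ i))`. -/
def power (X : Psh O) : (SymWords O)ᵒᵖ ⥤ Type u where
  obj p := ∀ i : Fin p.unop.len, X.obj (op (p.unop.letter i))
  map f := ↾ fun x i => X.map (f.unop.map i).op (x (f.unop.perm i))
  map_id p := by ext x i; exact X.map_id_apply _ _
  map_comp f g := by
    ext x i
    exact X.map_comp_apply (f.unop.map (g.unop.perm i)).op (g.unop.map i).op _

/-- The effect on powers of a map of presheaves. -/
def powerMap {X Y : Psh O} (φ : X ⟶ Y) (p : SymWords O)
    (x : (power X).obj (op p)) : (power Y).obj (op p) :=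
  fun i => φ.app _ (x i)

/-- The sum functor `(o₁, …, oₙ) ↦ y o₁ + ⋯ + y oₙ` from the free symmetric strict monoidal
category on `O` to the presheaves on `O`. -/
noncomputable def sumFunctor (O : Type u) [Category.{u} O] : SymWords O ⥤ Psh O where
  obj p := ∐ fun i : Fin p.len => yoneda.obj (p.letter i)
  map {p q} f := Limits.Sigma.desc fun i =>
    yoneda.map (f.map i) ≫ Limits.Sigma.ι (fun j => yoneda.obj (q.letter j)) (f.perm i)
  map_id p := by
    apply Limits.Sigma.hom_ext
    intro i
    erw [Limits.Sigma.ι_desc, Category.comp_id, yoneda.map_id, Category.id_comp]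
    rfl
  map_comp {p q r} f g := by
    apply Limits.Sigma.hom_ext
    intro i
    erw [Limits.Sigma.ι_desc, Limits.Sigma.ι_desc_assoc, Category.assoc, Limits.Sigma.ι_desc,
      yoneda.map_comp, Category.assoc]

/-- Analytic functors between presheaf categories in the sense of Fiore, Gambino, Hyland and
Winskel: the left Kan extensions along the sum functor of functors from the free symmetric
strict monoidal category on `O` to presheaves on `Q`. -/
def IsAnalytic (P : Psh O ⥤ Psh Q) : Prop :=
  ∃ (F : SymWords O ⥤ Psh Q) (α : F ⟶ sumFunctor O ⋙ P), P.IsLeftKanExtension α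

end Presheaves

/-! ### The fibration of graphs -/

/-- An object of the fibration of graphs over `Cat` for the free strict monoidal category monad
`M`: a small category `O` and a set-valued functor `A(o; p)`, contravariant in `o : O` and
covariant in `p : M(O)` (the fibres of a two-sided discrete fibration from `O` to `M(O)`). -/
structure Gph : Type (u + 1) where
  base : Cat.{u, u}
  graph : Words base ⥤ Psh base

namespace Gph

/-- A morphism of graphs over a functor `U : O ⥤ Q` consists of maps
`A(o; p) → B(U o; M(U) p)` natural in `o` and `p`. -/
@[ext]
structure Hom (A B : Gph.{u}) : Type u where
  base : A.base ⟶ B.base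
  app : ∀ (p : Words A.base) (o : (A.base)ᵒᵖ), (A.graph.obj p).obj o →
    (B.graph.obj ((wordsMap base.toFunctor).obj p)).obj (base.toFunctor.op.obj o)
  natural_left : ∀ (p : Words A.base) {o o' : (A.base)ᵒᵖ} (w : o ⟶ o') (a : (A.graph.obj p).obj o),
    app p o' ((A.graph.obj p).map w a) =
      (B.graph.obj ((wordsMap base.toFunctor).obj p)).map (base.toFunctor.op.map w) (app p o a)
  natural_right : ∀ {p q : Words A.base} (v : p ⟶ q) (o : (A.base)ᵒᵖ) (a : (A.graph.obj p).obj o),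
    app q o ((A.graph.map v).app o a) =
      (B.graph.map ((wordsMap base.toFunctor).map v)).app (base.toFunctor.op.obj o) (app p o a)

instance : Category.{u} Gph.{u} where
  Hom A B := Hom A B
  id A :=
    { base := 𝟙 A.base
      app := fun _ _ a => a
      natural_left := fun _ _ _ _ _ => rfl
      natural_right := fun v _ _ => by obtain ⟨v⟩ := v; rfl }
  comp f g :=
    { base := f.base ≫ g.base
      app := fun p o a => g.app _ _ (f.app p o a)
      natural_left := fun p _ _ w a => by
        rw [f.natural_left, g.natural_left]; rfl
      natural_right := fun v o a => by
        rw [f.natural_right, g.natural_right]; obtain ⟨v⟩ := v; rfl }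
  id_comp _ := rfl
  comp_id _ := rfl
  assoc _ _ _ := rfl

/-- The fibration of graphs. -/
def proj : Gph.{u} ⥤ Cat.{u, u} where
  obj A := A.base
  map f := f.base

end Gph

/-! ### The symmetrization monad -/

section SymGraph

variable {O : Type u} [Category.{u} O]

/-- The functor `p ↦ sM(O)(p, q)` on the opposite of `M(O)`. -/
abbrev homTo (q : Words O) : (Words O)ᵒᵖ ⥤ Type u :=
  (toSym O).op ⋙ yoneda.obj ((toSym O).obj q)

/-- The graph `S(A)(o; q) = ∫^{p ∈ M(O)} A(o; p) × sM(O)(p, q)`. -/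
def symGraph (A : Words O ⥤ Psh O) : Words O ⥤ Psh O where
  obj q :=
    { obj := fun o => Coend (A.flip.obj o) (homTo q)
      map := fun {o o'} w => ↾ Coend.lift
        (fun p a s => (Coend.mk p ((A.obj p).map w a) s :
          Coend (A.flip.obj o') (homTo q)))
        (fun {i j} v a s => by
          have h : (A.obj j).map w ((A.map v).app o a) = (A.map v).app o' ((A.obj i).map w a) :=
            (NatTrans.naturality_apply (A.map v) w a).symm
          exact (congrArg (fun t => (Coend.mk j t s : Coend (A.flip.obj o') (homTo q))) h).trans
            (Coend.condition (F := A.flip.obj o') (G := homTo q) v ((A.obj i).map w a) s))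
      map_id := fun o => by
        ext x
        induction x using Coend.ind with
        | h p a s =>
          exact congrArg (fun t => (Coend.mk p t s : Coend (A.flip.obj o) (homTo q)))
            ((A.obj p).map_id_apply o a)
      map_comp := fun {_ _ o} w w' => by
        ext x
        induction x using Coend.ind with
        | h p a s =>
          exact congrArg (fun t => (Coend.mk p t s : Coend (A.flip.obj o) (homTo q)))
            ((A.obj p).map_comp_apply w w' a) }
  map {q r} v :=
    { app := fun o => ↾ Coend.lift
        (fun p a s => (Coend.mk p a (s ≫ (toSym O).map v) : Coend (A.flip.obj o) (homTo r)))
        (fun {i j} v' a s => by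
          refine (Coend.condition (F := A.flip.obj o) (G := homTo r) v' a
            (s ≫ (toSym O).map v)).trans ?_
          exact congrArg (fun t => (Coend.mk i a t : Coend (A.flip.obj o) (homTo r)))
            (Category.assoc ((toSym O).map v') s ((toSym O).map v)).symm)
      naturality := fun o o' w => by
        ext x
        induction x using Coend.ind with
        | h p a s => rfl }
  map_id q := by
    ext o x
    induction x using Coend.ind with
    | h p a s =>
      refine congrArg (fun t => (Coend.mk p a t : Coend (A.flip.obj o) (homTo q))) ?_
      exact (congrArg (fun t => s ≫ t) ((toSym O).map_id q)).trans (Category.comp_id s)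
  map_comp {q q' r} v v' := by
    ext o x
    induction x using Coend.ind with
    | h p a s =>
      refine congrArg (fun t => (Coend.mk p a t : Coend (A.flip.obj o) (homTo r))) ?_
      exact (congrArg (fun t => s ≫ t) ((toSym O).map_comp v v')).trans
        (Category.assoc s _ _).symm

end SymGraph

namespace Gph

/-- The action of the symmetrization monad on morphisms of graphs over `U`:
`[a, s] ↦ [f a, sM(U) s]`. -/
def symHom {A B : Gph.{u}} (f : A ⟶ B) :
    (⟨A.base, symGraph A.graph⟩ : Gph.{u}) ⟶ ⟨B.base, symGraph B.graph⟩ where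
  base := f.base
  app q o := Coend.lift
    (fun p a s => (Coend.mk ((wordsMap f.base.toFunctor).obj p) (f.app p o a)
        ((symWordsMap f.base.toFunctor).map s) :
      Coend (B.graph.flip.obj (f.base.toFunctor.op.obj o))
        (homTo ((wordsMap f.base.toFunctor).obj q))))
    (fun {i j} v a s => by
      have h₁ := f.natural_right v o a
      have h₂ : (symWordsMap f.base.toFunctor).map ((toSym _).map v ≫ s) =
          (toSym _).map ((wordsMap f.base.toFunctor).map v) ≫
            (symWordsMap f.base.toFunctor).map s := by
        rw [Functor.map_comp, toSym_naturality]
        rfl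
      refine (congrArg (fun t => (Coend.mk ((wordsMap f.base.toFunctor).obj j) t
          ((symWordsMap f.base.toFunctor).map s) :
        Coend (B.graph.flip.obj (f.base.toFunctor.op.obj o))
          (homTo ((wordsMap f.base.toFunctor).obj q)))) h₁).trans ?_
      refine (Coend.condition (F := B.graph.flip.obj (f.base.toFunctor.op.obj o))
        (G := homTo ((wordsMap f.base.toFunctor).obj q))
        ((wordsMap f.base.toFunctor).map v) (f.app i o a) _).trans ?_
      exact congrArg (fun t => (Coend.mk ((wordsMap f.base.toFunctor).obj i) (f.app i o a) t :
        Coend (B.graph.flip.obj (f.base.toFunctor.op.obj o))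
          (homTo ((wordsMap f.base.toFunctor).obj q)))) h₂.symm)
  natural_left q o o' w x := by
    induction x using Coend.ind with
    | h p a s =>
      exact congrArg (fun t => (Coend.mk ((wordsMap f.base.toFunctor).obj p) t
          ((symWordsMap f.base.toFunctor).map s) :
        Coend (B.graph.flip.obj (f.base.toFunctor.op.obj o'))
          (homTo ((wordsMap f.base.toFunctor).obj q)))) (f.natural_left p w a)
  natural_right {q r} v o x := by
    induction x using Coend.ind with
    | h p a s =>
      refine congrArg (fun t => (Coend.mk ((wordsMap f.base.toFunctor).obj p) (f.app p o a) t :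
        Coend (B.graph.flip.obj (f.base.toFunctor.op.obj o))
          (homTo ((wordsMap f.base.toFunctor).obj r)))) ?_
      refine ((symWordsMap f.base.toFunctor).map_comp s ((toSym _).map v)).trans ?_
      rw [toSym_naturality]
      rfl

/-- The unit `a ↦ [a, 1]` of the symmetrization monad. -/
def symUnit (A : Gph.{u}) : A ⟶ ⟨A.base, symGraph A.graph⟩ where
  base := 𝟙 A.base
  app q o a := (Coend.mk q a (𝟙 ((toSym _).obj q)) : Coend (A.graph.flip.obj o) (homTo q))
  natural_left _ _ _ _ _ := rfl
  natural_right {p q} v o a := by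
    refine (Coend.condition (F := A.graph.flip.obj o) (G := homTo q) v a (𝟙 _)).trans ?_
    refine congrArg (fun t => (Coend.mk p a t : Coend (A.graph.flip.obj o) (homTo q))) ?_
    exact ((Category.comp_id ((toSym A.base).map v)).trans
      (congrArg (toSym A.base).map (wordsMap_id_map v).symm)).trans
      (Category.id_comp ((toSym A.base).map _)).symm

/-- The multiplication `[[a, s], t] ↦ [a, s ≫ t]` of the symmetrization monad. -/
def symMul (A : Gph.{u}) :
    (⟨A.base, symGraph (symGraph A.graph)⟩ : Gph.{u}) ⟶ ⟨A.base, symGraph A.graph⟩ where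
  base := 𝟙 A.base
  app r o := Coend.lift
    (fun q x t => Coend.lift
      (fun p a s => (Coend.mk p a (s ≫ t) : Coend (A.graph.flip.obj o) (homTo r)))
      (fun {i j} v a s => by
        refine (Coend.condition (F := A.graph.flip.obj o) (G := homTo r) v a (s ≫ t)).trans ?_
        exact congrArg (fun t => (Coend.mk i a t : Coend (A.graph.flip.obj o) (homTo r)))
          (Category.assoc ((toSym _).map v) s t).symm) x)
    (fun {i j} v x t => by
      induction x using Coend.ind with
      | h p a s =>
        exact congrArg (fun t => (Coend.mk p a t : Coend (A.graph.flip.obj o) (homTo r)))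
          (Category.assoc s ((toSym _).map v) t))
  natural_left r o o' w x := by
    induction x using Coend.ind with
    | h q x t =>
      induction x using Coend.ind with
      | h p a s => rfl
  natural_right {r r'} v o x := by
    induction x using Coend.ind with
    | h q x t =>
      induction x using Coend.ind with
      | h p a s =>
        obtain ⟨v⟩ := v
        exact congrArg (fun t => (Coend.mk p a t : Coend (A.graph.flip.obj o) (homTo _)))
          (Category.assoc s t _).symm

theorem hom_ext' {A B : Gph.{u}} {f g : A ⟶ B} (U : A.base ⟶ B.base) (hf : f.base = U)
    (hg : g.base = U) (h : ∀ p o a, HEq (f.app p o a) (g.app p o a)) : f = g := by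
  obtain ⟨U', f, f₁, f₂⟩ := f
  obtain ⟨U'', g, g₁, g₂⟩ := g
  dsimp only at hf hg
  subst hf
  subst hg
  obtain rfl : f = g := funext fun p => funext fun o => funext fun a => eq_of_heq (h p o a)
  rfl

/-- The symmetrization monad on the fibration of graphs over `Cat`; its unit and multiplication
are vertical. -/
def symMonad : Monad Gph.{u} where
  obj A := ⟨A.base, symGraph A.graph⟩
  map f := symHom f
  map_id A := hom_ext' (𝟙 A.base) rfl rfl fun q o x => by
    induction x using Coend.ind with
    | h p a s => rfl
  map_comp f g := hom_ext' (f.base ≫ g.base) rfl rfl fun q o x => by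
    induction x using Coend.ind with
    | h p a s => rfl
  η :=
    { app := symUnit
      naturality := fun A B f => hom_ext' f.base rfl rfl fun q o a => heq_of_eq <|
        congrArg (fun t => (Coend.mk ((wordsMap f.base.toFunctor).obj q) (f.app q o a) t :
          Coend (B.graph.flip.obj (f.base.toFunctor.op.obj o))
            (homTo ((wordsMap f.base.toFunctor).obj q))))
          ((symWordsMap f.base.toFunctor).map_id ((toSym _).obj q)).symm }
  μ :=
    { app := symMul
      naturality := fun A B f => hom_ext' f.base rfl rfl fun r o x => by
        induction x using Coend.ind with
        | h q x t =>
          induction x using Coend.ind with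
          | h p a s =>
            exact heq_of_eq <|
              congrArg (fun t => (Coend.mk ((wordsMap f.base.toFunctor).obj p) (f.app p o a) t :
                Coend (B.graph.flip.obj (f.base.toFunctor.op.obj o))
                  (homTo ((wordsMap f.base.toFunctor).obj r))))
                ((symWordsMap f.base.toFunctor).map_comp s t).symm }
  assoc A := hom_ext' (𝟙 A.base) rfl rfl fun q o x => by
    induction x using Coend.ind with
    | h r x w =>
      induction x using Coend.ind with
      | h q' x t =>
        induction x using Coend.ind with
        | h p a s =>
          exact heq_of_eq <|
            congrArg (fun t => (Coend.mk p a t : Coend (A.graph.flip.obj o) (homTo q)))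
              (Category.assoc s t w)
  left_unit A := hom_ext' (𝟙 A.base) rfl rfl fun q o x => by
    induction x using Coend.ind with
    | h p a s =>
      exact heq_of_eq <|
        congrArg (fun t => (Coend.mk p a t : Coend (A.graph.flip.obj o) (homTo q)))
          (Category.comp_id s)
  right_unit A := hom_ext' (𝟙 A.base) rfl rfl fun q o x => by
    induction x using Coend.ind with
    | h p a s =>
      exact heq_of_eq <|
        congrArg (fun t => (Coend.mk p a t : Coend (A.graph.flip.obj o) (homTo q)))
          (Category.id_comp s)

/-- The Eilenberg–Moore fibration of algebras for the symmetrization monad. -/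
def emProj : symMonad.{u}.Algebra ⥤ Cat.{u, u} := symMonad.forget ⋙ proj

end Gph

/-! ### The fibration of endofunctors on presheaf categories -/

/-- An object of the exponential fibration over `Cat`: a small category `O` and an endofunctor
of the category of presheaves on `O`. -/
structure EndPsh : Type (u + 1) where
  base : Cat.{u, u}
  functor : Psh base ⥤ Psh base

namespace EndPsh

/-- A morphism over `U : O ⥤ Q` from an endofunctor `P` to an endofunctor `R` is a natural
transformation `P U^* ⟶ U^* R`. -/
@[ext]
structure Hom (P R : EndPsh.{u}) : Type (u + 1) where
  base : P.base ⟶ R.base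
  trans : pull base.toFunctor ⋙ P.functor ⟶ R.functor ⋙ pull base.toFunctor

instance : Category.{u + 1} EndPsh.{u} where
  Hom P R := Hom P R
  id P :=
    { base := 𝟙 P.base
      trans := { app := fun X => 𝟙 (P.functor.obj X)
                 naturality := fun X Y φ =>
                   (Category.comp_id (P.functor.map φ)).trans
                     (Category.id_comp (P.functor.map φ)).symm } }
  comp {P R T} f g :=
    { base := f.base ≫ g.base
      trans :=
        { app := fun X => f.trans.app ((pull g.base.toFunctor).obj X) ≫
            (pull f.base.toFunctor).map (g.trans.app X)
          naturality := fun X Y φ => by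
            have hf := f.trans.naturality ((pull g.base.toFunctor).map φ)
            have hg := congrArg (pull f.base.toFunctor).map (g.trans.naturality φ)
            ext o x
            have hf' := NatTrans.congr_app hf o
            have hg' := NatTrans.congr_app hg o
            have hf'' := types_congr_hom hf' x
            refine (congrArg (((pull f.base.toFunctor).map (g.trans.app Y)).app o) hf'').trans ?_
            exact types_congr_hom hg' _ } }
  id_comp _ := Hom.ext rfl (heq_of_eq (by ext; rfl))
  comp_id _ := Hom.ext rfl (heq_of_eq (by ext; rfl))
  assoc _ _ _ := Hom.ext rfl (heq_of_eq (by ext; rfl))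

/-- The exponential fibration. -/
def proj : EndPsh.{u} ⥤ Cat.{u, u} where
  obj P := P.base
  map f := f.base

/-- The endofunctors of the presheaf category on `O`, as a functor into the total category. -/
def incl (O : Cat.{u, u}) : (Psh O ⥤ Psh O) ⥤ EndPsh.{u} where
  obj P := ⟨O, P⟩
  map τ := ⟨𝟙 O, { app := fun X => τ.app X, naturality := fun _ _ φ => τ.naturality φ }⟩
  map_id _ := rfl
  map_comp _ _ := rfl

theorem incl_comp_proj (O : Cat.{u, u}) : incl O ⋙ proj = (Functor.const _).obj O := rfl

/-- The endofunctors of the presheaf category on `O`, as a functor into the fibre over `O`. -/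
def toFiber (O : Cat.{u, u}) : (Psh O ⥤ Psh O) ⥤ Functor.Fiber proj.{u} O :=
  Functor.Fiber.inducedFunctor (incl_comp_proj O)

end EndPsh

/-! ### The representation of graphs -/

section Star

variable {O : Type u} [Category.{u} O]

/-- The set `(A ⋆ X)(o) = ∫^{p ∈ M(O)} A(o; p) × X^p`. -/
abbrev Star (A : Words O ⥤ Psh O) (X : Psh O) (o : Oᵒᵖ) : Type u :=
  Coend (A.flip.obj o) ((toSym O).op ⋙ power X)

/-- The class of `(a, x)` in `(A ⋆ X)(o)`. -/
abbrev Star.mk {A : Words O ⥤ Psh O} {X : Psh O} {o : Oᵒᵖ} (p : Words O) (a : (A.obj p).obj o)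
    (x : (power X).obj (op ((toSym O).obj p))) : Star A X o :=
  Coend.mk p a x

theorem Star.condition {A : Words O ⥤ Psh O} {X : Psh O} {o : Oᵒᵖ} {p q : Words O} (v : p ⟶ q)
    (a : (A.obj p).obj o) (x : (power X).obj (op ((toSym O).obj q))) :
    (Star.mk q ((A.map v).app o a) x : Star A X o) =
      Star.mk p a ((power X).map ((toSym O).map v).op x) :=
  Coend.condition (F := A.flip.obj o) (G := (toSym O).op ⋙ power X) v a x

/-- The endofunctor `X ↦ A ⋆ X` represented by a graph `A` over `O`. -/
def star (A : Words O ⥤ Psh O) : Psh O ⥤ Psh O where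
  obj X :=
    { obj := fun o => Star A X o
      map := fun {o o'} w => ↾ Coend.lift
        (fun p a x => (Star.mk p ((A.obj p).map w a) x : Star A X o'))
        (fun {i j} v a x => by
          have h : (A.obj j).map w ((A.map v).app o a) = (A.map v).app o' ((A.obj i).map w a) :=
            (NatTrans.naturality_apply (A.map v) w a).symm
          exact (congrArg (fun t => (Star.mk j t x : Star A X o')) h).trans
            (Star.condition v ((A.obj i).map w a) x))
      map_id := fun o => by
        ext y
        induction y using Coend.ind with
        | h p a x =>
          exact congrArg (fun t => (Star.mk p t x : Star A X o)) ((A.obj p).map_id_apply o a)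
      map_comp := fun {_ _ o} w w' => by
        ext y
        induction y using Coend.ind with
        | h p a x =>
          exact congrArg (fun t => (Star.mk p t x : Star A X o))
            ((A.obj p).map_comp_apply w w' a) }
  map {X Y} φ :=
    { app := fun o => ↾ Coend.lift
        (fun p a x => (Star.mk p a (powerMap φ _ x) : Star A Y o))
        (fun {i j} v a x => by
          refine (Star.condition v a (powerMap φ _ x)).trans ?_
          refine congrArg (fun t => (Star.mk i a t : Star A Y o)) ?_
          funext k
          exact (NatTrans.naturality_apply φ _ _).symm)
      naturality := fun o o' w => by
        ext y
        induction y using Coend.ind with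
        | h p a x => rfl }
  map_id X := by
    ext o y
    induction y using Coend.ind with
    | h p a x => rfl
  map_comp φ ψ := by
    ext o y
    induction y using Coend.ind with
    | h p a x => rfl

/-- The map `(A ⋆ X)(o) → (B ⋆ X)(o)` induced by a vertical morphism of graphs. -/
def starMap {A B : Words O ⥤ Psh O} (φ : A ⟶ B) (X : Psh O) (o : Oᵒᵖ) :
    Star A X o → Star B X o :=
  Coend.lift (fun p a x => (Star.mk p ((φ.app p).app o a) x : Star B X o))
    (fun {i j} v a x => by
      have h : (φ.app j).app o ((A.map v).app o a) = (B.map v).app o ((φ.app i).app o a) :=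
        types_congr_hom (NatTrans.congr_app (φ.naturality v) o) a
      exact (congrArg (fun t => (Star.mk j t x : Star B X o)) h).trans
        (Star.condition v ((φ.app i).app o a) x))

/-- The map `(S(A) ⋆ X)(o) → (A ⋆ X)(o)` given by `[[a, (σ, v)], x] ↦ [a, i ↦ X (v i) (x (σ i))]`.
-/
def zeta (A : Words O ⥤ Psh O) (X : Psh O) (o : Oᵒᵖ) : Star (symGraph A) X o → Star A X o :=
  Coend.lift
    (fun q y x => Coend.lift
      (fun p a s => (Star.mk p a ((power X).map (Quiver.Hom.op s) x) : Star A X o))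
      (fun {i j} v a s => by
        refine (Star.condition v a ((power X).map (Quiver.Hom.op s) x)).trans ?_
        refine congrArg (fun t => (Star.mk i a t : Star A X o)) ?_
        exact ((power X).map_comp_apply (Quiver.Hom.op s) ((toSym O).map v).op x).symm) y)
    (fun {i j} v y x => by
      induction y using Coend.ind with
      | h p a s =>
        exact congrArg (fun t => (Star.mk p a t : Star A X o))
          ((power X).map_comp_apply ((toSym O).map v).op (Quiver.Hom.op s) x))

end Star

namespace Gph

/-- The representation on morphisms of graphs over `U : O ⥤ Q`: the map
`(A ⋆ U^* X)(o) → (B ⋆ X)(U o)`, `[a, x] ↦ [f a, x]`. -/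
def starHom {A B : Gph.{u}} (f : A ⟶ B) (X : Psh B.base) (o : (A.base)ᵒᵖ) :
    Star A.graph ((pull f.base.toFunctor).obj X) o →
      Star B.graph X (f.base.toFunctor.op.obj o) :=
  Coend.lift (fun p a x =>
      (Star.mk ((wordsMap f.base.toFunctor).obj p) (f.app p o a) x :
        Star B.graph X (f.base.toFunctor.op.obj o)))
    (fun {i j} v a x => by
      refine (congrArg (fun t => (Star.mk ((wordsMap f.base.toFunctor).obj j) t x :
        Star B.graph X (f.base.toFunctor.op.obj o))) (f.natural_right v o a)).trans ?_
      refine (Star.condition ((wordsMap f.base.toFunctor).map v) (f.app i o a) x).trans ?_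
      obtain ⟨v⟩ := v
      rfl)

/-- The representation of graphs as endofunctors on presheaf categories. -/
def rep : Gph.{u} ⥤ EndPsh.{u} where
  obj A := ⟨A.base, star A.graph⟩
  map {A B} f := ⟨f.base,
    { app := fun X =>
        { app := fun o => ↾ starHom f X o
          naturality := fun o o' w => by
            ext y
            induction y using Coend.ind with
            | h p a x =>
              exact congrArg (fun t => (Star.mk ((wordsMap f.base.toFunctor).obj p) t x :
                Star B.graph X (f.base.toFunctor.op.obj o'))) (f.natural_left p w a) }
      naturality := fun X Y φ => by
        ext o y
        induction y using Coend.ind with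
        | h p a x => rfl }⟩
  map_id A := EndPsh.Hom.ext rfl (heq_of_eq (by
    ext X o y
    induction y using Coend.ind with
    | h p a x => rfl))
  map_comp f g := EndPsh.Hom.ext rfl (heq_of_eq (by
    ext X o y
    induction y using Coend.ind with
    | h p a x => rfl))

end Gph

/-! ### The representation of algebras for the symmetrization monad -/

section StarLemmas

variable {O : Type u} [Category.{u} O]

theorem starMap_naturality {A B : Words O ⥤ Psh O} (φ : A ⟶ B) (X : Psh O) {o o' : Oᵒᵖ}
    (w : o ⟶ o') (z : Star A X o) :
    starMap φ X o' (((star A).obj X).map w z) = ((star B).obj X).map w (starMap φ X o z) := by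
  induction z using Coend.ind with
  | h p a x =>
    exact congrArg (fun t => (Star.mk p t x : Star B X o'))
      (NatTrans.naturality_apply (φ.app p) w a)

theorem starMap_map {A B : Words O ⥤ Psh O} (φ : A ⟶ B) {X Y : Psh O} (ψ : X ⟶ Y) (o : Oᵒᵖ)
    (z : Star A X o) :
    starMap φ Y o (((star A).map ψ).app o z) = ((star B).map ψ).app o (starMap φ X o z) := by
  induction z using Coend.ind with
  | h p a x => rfl

theorem zeta_naturality (A : Words O ⥤ Psh O) (X : Psh O) {o o' : Oᵒᵖ}
    (w : o ⟶ o') (z : Star (symGraph A) X o) :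
    zeta A X o' (((star (symGraph A)).obj X).map w z) =
      ((star A).obj X).map w (zeta A X o z) := by
  induction z using Coend.ind with
  | h q y x =>
    induction y using Coend.ind with
    | h p a s => rfl

theorem zeta_map (A : Words O ⥤ Psh O) {X Y : Psh O} (ψ : X ⟶ Y) (o : Oᵒᵖ)
    (z : Star (symGraph A) X o) :
    zeta A Y o (((star (symGraph A)).map ψ).app o z) =
      ((star A).map ψ).app o (zeta A X o z) := by
  induction z using Coend.ind with
  | h q y x =>
    induction y using Coend.ind with
    | h p a s =>
      refine congrArg (fun t => (Star.mk p a t : Star A Y o)) ?_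
      funext k
      exact (NatTrans.naturality_apply ψ _ _).symm

end StarLemmas

namespace Gph

/-- A morphism of graphs over `𝟙 O`, regarded as a natural transformation. -/
def vertical {O : Cat.{u, u}} {A B : Words O ⥤ Psh O}
    (f : (⟨O, A⟩ : Gph.{u}) ⟶ ⟨O, B⟩) (h : f.base = 𝟙 O) : A ⟶ B where
  app p :=
    { app := fun o => ↾ fun a =>
        cast (congrArg (fun U : O ⟶ O =>
          (B.obj ((wordsMap U.toFunctor).obj p)).obj (U.toFunctor.op.obj o)) h) (f.app p o a)
      naturality := fun o o' w => by
        obtain ⟨U, f, f₁, f₂⟩ := f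
        dsimp only at h
        subst h
        ext a
        exact f₁ p w a }
  naturality p q v := by
    obtain ⟨U, f, f₁, f₂⟩ := f
    dsimp only at h
    subst h
    ext o a
    refine (f₂ v o a).trans ?_
    obtain ⟨v⟩ := v
    rfl

theorem algebra_base (A : symMonad.{u}.Algebra) : A.a.base = 𝟙 A.A.base :=
  congrArg Hom.base A.unit

/-- The action `S(A) ⟶ A` of an algebra for the symmetrization monad, as a natural
transformation. -/
def action (A : symMonad.{u}.Algebra) : symGraph A.A.graph ⟶ A.A.graph :=
  vertical A.a (algebra_base A)

theorem vertical_comm {A B : Gph.{u}} (f : A ⟶ B)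
    (a : (⟨A.base, symGraph A.graph⟩ : Gph.{u}) ⟶ ⟨A.base, A.graph⟩) (ha : a.base = 𝟙 A.base)
    (b : (⟨B.base, symGraph B.graph⟩ : Gph.{u}) ⟶ ⟨B.base, B.graph⟩) (hb : b.base = 𝟙 B.base)
    (h : symHom f ≫ b = a ≫ f) (p : Words A.base) (o : (A.base)ᵒᵖ)
    (x : ((symGraph A.graph).obj p).obj o) :
    f.app p o (((vertical a ha).app p).app o x) =
      ((vertical b hb).app _).app _ ((symHom f).app p o x) := by
  obtain ⟨U, a, a₁, a₂⟩ := a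
  obtain ⟨V, b, b₁, b₂⟩ := b
  dsimp only at ha hb
  subst ha
  subst hb
  have h' := eq_of_heq (Hom.ext_iff.mp h).2
  exact (congrFun (congrFun (congrFun h' p) o) x).symm

theorem starHom_starMap {A B : symMonad.{u}.Algebra} (f : A ⟶ B) (X : Psh B.A.base)
    (o : (A.A.base)ᵒᵖ) (z : Star (symGraph A.A.graph) ((pull f.f.base.toFunctor).obj X) o) :
    starHom f.f X o (starMap (action A) _ o z) =
      starMap (action B) X _ (starHom (symHom f.f) X o z) := by
  induction z using Coend.ind with
  | h p y x =>
    exact congrArg (fun t => (Star.mk ((wordsMap f.f.base.toFunctor).obj p) t x :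
      Star B.A.graph X (f.f.base.toFunctor.op.obj o)))
      (vertical_comm f.f A.a (algebra_base A) B.a (algebra_base B) f.h p o y)

theorem starHom_zeta {A B : Gph.{u}} (f : A ⟶ B) (X : Psh B.base)
    (o : (A.base)ᵒᵖ) (z : Star (symGraph A.graph) ((pull f.base.toFunctor).obj X) o) :
    starHom f X o (zeta A.graph _ o z) = zeta B.graph X _ (starHom (symHom f) X o z) := by
  induction z using Coend.ind with
  | h q y x =>
    induction y using Coend.ind with
    | h p a s => rfl

/-- The value at `X` and `o` of the endofunctor represented by an algebra `A` for the
symmetrization monad: the coequalizer of the maps `(S(A) ⋆ X)(o) ⇉ (A ⋆ X)(o)` given by the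
action of the algebra and by `zeta`. -/
abbrev AlgStar (A : symMonad.{u}.Algebra) (X : Psh A.A.base) (o : (A.A.base)ᵒᵖ) : Type u :=
  Function.Coequalizer (starMap (action A) X o) (zeta A.A.graph X o)

/-- The endofunctor represented by an algebra for the symmetrization monad. -/
def algStar (A : symMonad.{u}.Algebra) : Psh A.A.base ⥤ Psh A.A.base where
  obj X :=
    { obj := fun o => AlgStar A X o
      map := fun {o o'} w => ↾ Quot.map (fun z => ((star A.A.graph).obj X).map w z) (by
        rintro _ _ ⟨z⟩
        rw [← starMap_naturality, ← zeta_naturality]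
        exact .intro _)
      map_id := fun o => by
        ext z
        induction z using Quot.ind with
        | mk z => exact congrArg (Quot.mk _) (((star A.A.graph).obj X).map_id_apply o z)
      map_comp := fun w w' => by
        ext z
        induction z using Quot.ind with
        | mk z => exact congrArg (Quot.mk _) (((star A.A.graph).obj X).map_comp_apply w w' z) }
  map {X Y} φ :=
    { app := fun o => ↾ Quot.map (fun z => ((star A.A.graph).map φ).app o z) (by
        rintro _ _ ⟨z⟩
        rw [← starMap_map, ← zeta_map]
        exact .intro _)
      naturality := fun o o' w => by
        ext z
        induction z using Quot.ind with
        | mk z =>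
          exact congrArg (Quot.mk _) (NatTrans.naturality_apply ((star A.A.graph).map φ) w z) }
  map_id X := by
    ext o z
    induction z using Quot.ind with
    | mk z =>
      exact congrArg (Quot.mk _)
        (types_congr_hom (NatTrans.congr_app ((star A.A.graph).map_id X) o) z)
  map_comp φ ψ := by
    ext o z
    induction z using Quot.ind with
    | mk z =>
      exact congrArg (Quot.mk _)
        (types_congr_hom (NatTrans.congr_app ((star A.A.graph).map_comp φ ψ) o) z)

/-- The representation of the Eilenberg–Moore fibration of the symmetrization monad in the
fibration of endofunctors on presheaf categories. -/
def emRep : symMonad.{u}.Algebra ⥤ EndPsh.{u} where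
  obj A := ⟨A.A.base, algStar A⟩
  map {A B} f := ⟨f.f.base,
    { app := fun X =>
        { app := fun o => ↾ Quot.map (starHom f.f X o) (by
            rintro _ _ ⟨z⟩
            rw [starHom_starMap, starHom_zeta]
            exact .intro _)
          naturality := fun o o' w => by
            ext z
            induction z using Quot.ind with
            | mk z =>
              exact congrArg (Quot.mk _)
                (NatTrans.naturality_apply ((rep.map f.f).trans.app X) w z) }
      naturality := fun X Y φ => by
        ext o z
        induction z using Quot.ind with
        | mk z =>
          exact congrArg (Quot.mk _)
            (types_congr_hom (NatTrans.congr_app ((rep.map f.f).trans.naturality φ) o) z) }⟩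
  map_id A := EndPsh.Hom.ext rfl (heq_of_eq (by
    ext X o z
    induction z using Quot.ind with
    | mk z =>
      induction z using Coend.ind with
      | h p a x => rfl))
  map_comp f g := EndPsh.Hom.ext rfl (heq_of_eq (by
    ext X o z
    induction z using Quot.ind with
    | mk z =>
      induction z using Coend.ind with
      | h p a x => rfl))

theorem emRep_comp_proj : emRep.{u} ⋙ EndPsh.proj = emProj := rfl

/-- The restriction of `emRep` to the fibres over a small category `O`. -/
def emRepFiber (O : Cat.{u, u}) :
    Functor.Fiber emProj.{u} O ⥤ Functor.Fiber EndPsh.proj.{u} O :=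
  Functor.Fiber.inducedFunctor (F := Functor.Fiber.fiberInclusion ⋙ emRep)
    (Functor.Fiber.fiberInclusion_comp_eq_const (p := emProj.{u}) (S := O))

/-- The action `[a, s] ↦ F(s)(a)` on the restriction of `F : sM(O) ⥤ Psh O` along
`M(O) ⥤ sM(O)`. -/
def restrictAction {O : Cat.{u, u}} (F : SymWords O ⥤ Psh O) :
    (⟨O, symGraph (toSym O ⋙ F)⟩ : Gph.{u}) ⟶ ⟨O, toSym O ⋙ F⟩ where
  base := 𝟙 O
  app q o := Coend.lift (fun p a s => (F.map s).app o a)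
    (fun {i j} v a s => (types_congr_hom (NatTrans.congr_app
      (F.map_comp ((toSym O).map v) s) o) a).symm)
  natural_left q o o' w y := by
    induction y using Coend.ind with
    | h p a s => exact NatTrans.naturality_apply (F.map s) w a
  natural_right {q r} v o y := by
    induction y using Coend.ind with
    | h p a s =>
      obtain ⟨v⟩ := v
      exact types_congr_hom (NatTrans.congr_app (F.map_comp s _) o) a

theorem restrictAction_unit {O : Cat.{u, u}} (F : SymWords O ⥤ Psh O) :
    symUnit ⟨O, toSym O ⋙ F⟩ ≫ restrictAction F = 𝟙 (⟨O, toSym O ⋙ F⟩ : Gph.{u}) :=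
  hom_ext' (𝟙 O) rfl rfl fun q o a => heq_of_eq
    (types_congr_hom (NatTrans.congr_app (F.map_id ((toSym O).obj q)) o) a)

theorem restrictAction_assoc {O : Cat.{u, u}} (F : SymWords O ⥤ Psh O) :
    symMul ⟨O, toSym O ⋙ F⟩ ≫ restrictAction F =
      symHom (restrictAction F) ≫ restrictAction F :=
  hom_ext' (𝟙 O) rfl rfl fun r o y => by
    induction y using Coend.ind with
    | h q y t =>
      induction y using Coend.ind with
      | h p a s =>
        exact heq_of_eq (types_congr_hom (NatTrans.congr_app (F.map_comp s t) o) a)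

/-- The algebra given by the restriction of `F : sM(O) ⥤ Psh O` along `M(O) ⥤ sM(O)`. -/
def restrictAlgebra {O : Cat.{u, u}} (F : SymWords O ⥤ Psh O) : symMonad.{u}.Algebra where
  A := ⟨O, toSym O ⋙ F⟩
  a := restrictAction F
  unit := restrictAction_unit F
  assoc := restrictAction_assoc F

/-- The morphism of graphs given by the restriction of a natural transformation along
`M(O) ⥤ sM(O)`. -/
def restrictHom {O : Cat.{u, u}} {F G : SymWords O ⥤ Psh O} (φ : F ⟶ G) :
    (⟨O, toSym O ⋙ F⟩ : Gph.{u}) ⟶ ⟨O, toSym O ⋙ G⟩ where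
  base := 𝟙 O
  app p o a := (φ.app ((toSym O).obj p)).app o a
  natural_left p o o' w a := NatTrans.naturality_apply (φ.app ((toSym O).obj p)) w a
  natural_right v o a := by
    obtain ⟨v⟩ := v
    exact types_congr_hom (NatTrans.congr_app (φ.naturality _) o) a

theorem restrictHom_comm {O : Cat.{u, u}} {F G : SymWords O ⥤ Psh O} (φ : F ⟶ G) :
    symHom (restrictHom φ) ≫ restrictAction G = restrictAction F ≫ restrictHom φ :=
  hom_ext' (𝟙 O) rfl rfl fun q o y => by
    induction y using Coend.ind with
    | h p a s =>
      exact heq_of_eq (types_congr_hom (NatTrans.congr_app (φ.naturality s) o) a).symm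

/-- The functor sending `F : sM(O) ⥤ Psh O` to the algebra whose underlying graph is the
restriction of `F` along `M(O) ⥤ sM(O)`, with action `[a, s] ↦ F(s)(a)`. -/
def restrict (O : Cat.{u, u}) : (SymWords O ⥤ Psh O) ⥤ symMonad.{u}.Algebra where
  obj F := restrictAlgebra F
  map φ := ⟨restrictHom φ, restrictHom_comm φ⟩
  map_id _ := rfl
  map_comp _ _ := rfl

theorem restrict_comp_proj (O : Cat.{u, u}) :
    restrict O ⋙ emProj = (Functor.const _).obj O := rfl

/-- The functor `restrict O`, with values in the fibre over `O`. -/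
def restrictFiber (O : Cat.{u, u}) :
    (SymWords O ⥤ Psh O) ⥤ Functor.Fiber emProj.{u} O :=
  Functor.Fiber.inducedFunctor (restrict_comp_proj O)

end Gph

end Symmetrization

/-! An `S`-algebra structure on a functor `A` on `M(O)` is an action of all morphisms of `sM(O)` on
`A`. The unit and associativity laws, read on `[x, 1]` and `[[x, s], t]`, are functoriality. The
coend relation together with the unit law (`act_toSym`) makes this action agree with the given one
on `M(O)`. Hence algebras over `O` are functors on `sM(O)`, and algebra maps over the identity are
natural transformations.

The coend `A ⋆ X` already imposes `[F(v)a, x] = [a, v^* x]` for `v` in `M(O)`. The coequalizer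
imposes it for every `s` in `sM(O)`, so it computes the coend of `F(p) × X^p` over `sM(O)`. By
Yoneda, `X^p` is the set of maps `ι p ⟶ X`, naturally in `p` and `X`. This coend is therefore the
pointwise formula for the left Kan extension along `ι` (`kanUnitIsPointwise`).

The essential image is taken in the total category, where an isomorphism may lie over any
isomorphism of small categories. The second claim thus also requires that analyticity survive
conjugation by reindexing along such an isomorphism (`EndPsh.isAnalytic_of_iso`). -/

namespace Symmetrization

/-! ### Recognition of the left Kan extension functor. -/

section Lan

variable {C D H : Type*} [Category* C] [Category* D] [Category* H]

/-- A functor whose values are left Kan extensions along `S`, naturally, is isomorphic to `S.lan`.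
-/
noncomputable def isoLan (S : C ⥤ D) (L : (C ⥤ H) ⥤ (D ⥤ H)) [∀ F : C ⥤ H, S.HasLeftKanExtension F]
    (η : ∀ F, F ⟶ S ⋙ L.obj F)
    (hη : ∀ {F G : C ⥤ H} (φ : F ⟶ G), η F ≫ S.whiskerLeft (L.map φ) = φ ≫ η G)
    (h : ∀ F, (L.obj F).IsLeftKanExtension (η F)) : L ≅ S.lan :=
  NatIso.ofComponents
    (fun F => have := h F
      Functor.leftKanExtensionUnique (L.obj F) (η F)
        (S.leftKanExtension F) (S.leftKanExtensionUnit F))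
    (fun {F G} φ => by
      have := h F
      have := h G
      -- Maps out of `L.obj F` are determined by their restriction along `η F`, where `hη` and the
      -- naturality of the unit of `S.lan` apply.
      apply Functor.hom_ext_of_isLeftKanExtension (L.obj F) (η F)
      rw [Functor.whiskerLeft_comp, ← Category.assoc, hη, Category.assoc]
      dsimp only [Functor.leftKanExtensionUnique, Functor.leftKanExtensionUniqueOfIso,
        Functor.lan]
      simp)

end Lan

/-! ### Powers of a presheaf as maps out of sums of representables. -/

section Classify

variable {O : Type u} [Category.{u} O]

/-- The coproduct injection `y (p i) ⟶ y p₁ + ⋯ + y pₙ`. -/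
noncomputable def sumι (p : SymWords O) (i : Fin p.len) :
    yoneda.obj (p.letter i) ⟶ (sumFunctor O).obj p :=
  Limits.Sigma.ι (fun j => yoneda.obj (p.letter j)) i

theorem sumι_map {p q : SymWords O} (s : p ⟶ q) (i : Fin p.len) :
    sumι p i ≫ (sumFunctor O).map s = yoneda.map (s.map i) ≫ sumι q (s.perm i) :=
  Limits.Sigma.ι_desc _ _

/-- The generic element of the power of a sum of representables. -/
noncomputable def generic (p : SymWords O) : (power ((sumFunctor O).obj p)).obj (op p) :=
  fun i => yonedaEquiv (sumι p i)

/-- The map out of a sum of representables that corresponds to an element of a power. -/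
noncomputable def classify {X : Psh O} (p : SymWords O) (x : (power X).obj (op p)) :
    (sumFunctor O).obj p ⟶ X :=
  Limits.Sigma.desc fun i => yonedaEquiv.symm (x i)

theorem sumι_classify {X : Psh O} (p : SymWords O) (x : (power X).obj (op p)) (i : Fin p.len) :
    sumι p i ≫ classify p x = yonedaEquiv.symm (x i) :=
  Limits.Sigma.ι_desc _ _

theorem sum_hom_ext {X : Psh O} {p : SymWords O} {f g : (sumFunctor O).obj p ⟶ X}
    (h : ∀ i, sumι p i ≫ f = sumι p i ≫ g) : f = g :=
  Limits.Sigma.hom_ext _ _ h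

/-- With `classify_powerMap_generic`, this is the Yoneda bijection between `X^p` and the maps `ι p ⟶
X`, under which the generic element corresponds to the identity. -/
theorem powerMap_generic_classify {X : Psh O} (p : SymWords O) (x : (power X).obj (op p)) :
    powerMap (classify p x) p (generic p) = x := by
  funext i
  have h := congrArg yonedaEquiv (sumι_classify p x i)
  rw [yonedaEquiv_comp, Equiv.apply_symm_apply] at h
  exact h

theorem classify_powerMap_generic {X : Psh O} (p : SymWords O) (f : (sumFunctor O).obj p ⟶ X) :
    classify p (powerMap f p (generic p)) = f :=
  sum_hom_ext fun i => by
    rw [sumι_classify]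
    apply yonedaEquiv.injective
    rw [yonedaEquiv_comp, Equiv.apply_symm_apply]
    rfl

theorem classify_comp {X Y : Psh O} (p : SymWords O) (x : (power X).obj (op p)) (f : X ⟶ Y) :
    classify p x ≫ f = classify p (powerMap f p x) := by
  conv_lhs => rw [← classify_powerMap_generic p (classify p x ≫ f)]
  congr 1
  conv_rhs => rw [← powerMap_generic_classify p x]
  rfl

/-- Naturality of the bijection in the word. It turns an identity `x' = s^* x` into a morphism of
the comma category of `ι` over `X`, over which the Kan extension is a colimit. -/
theorem map_classify {X : Psh O} {p q : SymWords O} (s : p ⟶ q) (x : (power X).obj (op q)) :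
    (sumFunctor O).map s ≫ classify q x = classify p ((power X).map s.op x) :=
  sum_hom_ext fun i => by
    rw [sumι_classify, ← Category.assoc, sumι_map, Category.assoc, sumι_classify]
    exact yonedaEquiv_symm_naturality_left (s.map i) X (x (s.perm i))

theorem powerMap_map_generic {p q : SymWords O} (s : p ⟶ q) :
    powerMap ((sumFunctor O).map s) p (generic p) =
      (power ((sumFunctor O).obj q)).map s.op (generic q) := by
  have h := map_classify s (generic q)
  have h' : classify q (generic q) = 𝟙 _ := classify_powerMap_generic q (𝟙 _)
  rw [h', Category.comp_id] at h
  rw [h, powerMap_generic_classify]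

end Classify

/-! ### The represented endofunctor as a pointwise Kan extension. -/

namespace Gph

section Kan

variable {O : Cat.{u, u}}

/-- A word, as an object of the free strict monoidal category. -/
abbrev toWords (p : SymWords O) : Words O := ⟨p.len, p.letter⟩

/-- The class of `(a, x)` in the presheaf represented by the restriction of `F`. -/
def algMk (F : SymWords O ⥤ Psh O) {X : Psh O} {o : (O : Type u)ᵒᵖ} (p : SymWords O)
    (a : (F.obj p).obj o) (x : (power X).obj (op p)) :
    ((algStar (restrictAlgebra F)).obj X).obj o :=
  Quot.mk _ (Star.mk (A := toSym O ⋙ F) (toWords p) a x)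

/-- The coequalizer relation at `[[a, s], x]`: the action sends it to `[F(s)a, x]` and `zeta` sends
it to `[a, s^* x]`. Thus permutations too may be moved across the pair. -/
theorem algMk_condition (F : SymWords O ⥤ Psh O) {X : Psh O} {o : (O : Type u)ᵒᵖ}
    {p q : SymWords O} (s : p ⟶ q) (a : (F.obj p).obj o) (x : (power X).obj (op q)) :
    algMk F q ((F.map s).app o a) x = algMk F p a ((power X).map s.op x) :=
  Quot.sound (Function.Coequalizer.Rel.intro
    (Star.mk (A := symGraph (toSym O ⋙ F)) (toWords q) (Coend.mk (toWords p) a s) x))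

theorem algMk_ind (F : SymWords O ⥤ Psh O) {X : Psh O} {o : (O : Type u)ᵒᵖ}
    {motive : ((algStar (restrictAlgebra F)).obj X).obj o → Prop}
    (h : ∀ p a x, motive (algMk F p a x)) (z) : motive z := by
  induction z using Quot.ind with
  | mk z =>
    induction z using Coend.ind with
    | h p a x => exact h ((toSym O).obj p) a x

/-- The universal property of the presheaf represented by the restriction of `F`. -/
def algLift (F : SymWords O ⥤ Psh O) {X : Psh O} {o : (O : Type u)ᵒᵖ} {T : Type u}
    (f : ∀ p : SymWords O, (F.obj p).obj o → (power X).obj (op p) → T)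
    (hf : ∀ {p q : SymWords O} (s : p ⟶ q) (a : (F.obj p).obj o) (x : (power X).obj (op q)),
      f q ((F.map s).app o a) x = f p a ((power X).map s.op x)) :
    ((algStar (restrictAlgebra F)).obj X).obj o → T :=
  Quot.lift (Coend.lift (fun p a x => f ((toSym O).obj p) a x)
    (fun v a x => hf ((toSym O).map v) a x)) (by
      rintro _ _ ⟨z⟩
      induction z using Coend.ind with
      | h q y x =>
        induction y using Coend.ind with
        | h p a s => exact hf s a x)

/-- The unit `a ↦ [a, generic]` of the Kan extension. -/
noncomputable def kanUnit (F : SymWords O ⥤ Psh O) :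
    F ⟶ sumFunctor O ⋙ algStar (restrictAlgebra F) where
  app p :=
    { app := fun o => ↾ fun a => algMk F p a (generic p)
      naturality := fun o o' w => by ext a; rfl }
  naturality p q s := by
    ext o a
    refine (algMk_condition F s a (generic q)).trans ?_
    rw [← powerMap_map_generic]
    rfl

/-- The functor represented by the restriction of `F` is a pointwise left Kan extension. -/
noncomputable def kanUnitIsPointwise (F : SymWords O ⥤ Psh O) :
    (Functor.LeftExtension.mk _ (kanUnit F)).IsPointwiseLeftKanExtension := fun X =>
  { desc := fun c =>
      { app := fun o => ↾ algLift F
          -- An element `x` of `X^p` is an object `ι p ⟶ X` of the comma category, so `[a, x]` goes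
          -- to the leg of the cocone at that object, applied to `a`.
          (fun p a x => (c.ι.app (CostructuredArrow.mk (classify p x))).app o a)
          (fun {p q} s a x => by
            have h := c.w (CostructuredArrow.homMk
              (f := CostructuredArrow.mk (classify p ((power X).map s.op x)))
              (f' := CostructuredArrow.mk (classify q x)) s (map_classify s x))
            exact types_congr_hom (NatTrans.congr_app h o) a)
        naturality := fun o o' w => by
          ext z
          induction z using algMk_ind with
          | h p a x =>
            exact NatTrans.naturality_apply
              (c.ι.app (CostructuredArrow.mk (classify p x))) w a }
    fac := fun c g => by
      obtain ⟨p, ⟨⟩, f⟩ := g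
      ext o a
      change (c.ι.app (CostructuredArrow.mk
        (classify p (powerMap f p (generic p))))).app o a = _
      rw [classify_powerMap_generic]
      rfl
    uniq := fun c m hm => by
      ext o z
      induction z using algMk_ind with
      | h p a x =>
        have h := types_congr_hom
          (NatTrans.congr_app (hm (CostructuredArrow.mk (classify p x))) o) a
        refine Eq.trans ?_ h
        -- `[a, x]` is the image of `[a, generic]` under `classify p x`, so the legs of the cocone
        -- determine `m`.
        change (m.app o) _ = (m.app o) (algMk F p a (powerMap (classify p x) p (generic p)))
        rw [powerMap_generic_classify] }

instance isLeftKanExtension_kanUnit (F : SymWords O ⥤ Psh O) :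
    (algStar (restrictAlgebra F)).IsLeftKanExtension (kanUnit F) :=
  (kanUnitIsPointwise F).isLeftKanExtension

variable (O) in
/-- The functor sending `F` to the endofunctor represented by its restriction. -/
def analyticRep : (SymWords O ⥤ Psh O) ⥤ (Psh O ⥤ Psh O) where
  obj F := algStar (restrictAlgebra F)
  map φ := (emRep.map ((restrict O).map φ)).trans
  map_id F := by
    ext X o z
    induction z using algMk_ind with
    | h p a x => rfl
  map_comp φ ψ := by
    ext X o z
    induction z using algMk_ind with
    | h p a x => rfl

/-- The representation of functors on words is the left Kan extension along the sum functor. -/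
noncomputable def analyticRepIsoLan : analyticRep O ≅ (sumFunctor O).lan :=
  isoLan (sumFunctor O) (analyticRep O) (fun F => kanUnit F) (fun _ => rfl)
    isLeftKanExtension_kanUnit

/-- On the fibres, restriction followed by the representation is `analyticRep`. -/
def restrictFiberRepIso :
    restrictFiber O ⋙ emRepFiber O ≅ analyticRep O ⋙ EndPsh.toFiber O :=
  NatIso.ofComponents (fun F => Iso.refl _) (fun φ => by
    exact (Category.comp_id _).trans (Category.id_comp _).symm)

end Kan

end Gph

/-! ### Algebras over `O` as functors on `sM(O)`. -/

namespace Gph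

section Equivalence

variable {O : Cat.{u, u}}

theorem exists_restrict_map {F G : SymWords O ⥤ Psh O}
    (g : (restrict O).obj F ⟶ (restrict O).obj G) (hg : g.f.base = 𝟙 O) :
    ∃ φ : F ⟶ G, (restrict O).map φ = g := by
  obtain ⟨⟨U, g, g₁, g₂⟩, h⟩ := g
  dsimp only at hg
  subst hg
  refine ⟨{ app := fun p =>
              { app := fun o => ↾ g (toWords p) o
                naturality := fun o o' w => by ext a; exact g₁ (toWords p) w a }
            naturality := fun p q s => ?_ }, rfl⟩
  ext o a
  -- Compatibility with the actions, evaluated at `[a, s]`, is the naturality square at `s`.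
  have h' := eq_of_heq (Hom.ext_iff.mp h).2
  exact (congrFun (congrFun (congrFun h' (toWords q)) o)
    (Coend.mk (F := (toSym O ⋙ F).flip.obj o) (toWords p) a s)).symm

/-- Objects of a fibre lie over `O` only up to a propositional equality. When both bases are `O` by
definition, the `eqToHom` reduces to the identity. -/
theorem base_eq_id_of_fiber {A B : Functor.Fiber emProj.{u} O} (f : A ⟶ B)
    (hA : A.1.A.base = O) (hB : B.1.A.base = O) :
    f.1.f.base = eqToHom (hA.trans hB.symm) := by
  have := f.2
  have h := IsHomLift.fac' emProj (𝟙 O) f.1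
  rw [Category.id_comp, eqToHom_trans] at h
  exact h

instance full_restrictFiber : (restrictFiber O).Full where
  map_surjective {F G} f := by
    obtain ⟨φ, hφ⟩ := exists_restrict_map (F := F) (G := G) f.1
      (base_eq_id_of_fiber f rfl rfl)
    exact ⟨φ, Subtype.ext hφ⟩

instance faithful_restrictFiber : (restrictFiber O).Faithful where
  map_injective {F G φ ψ} h := by
    have h₁ := congrArg (fun f => Monad.Algebra.Hom.f f.1) h
    have h₂ := eq_of_heq (Hom.ext_iff.mp h₁).2
    ext p o a
    exact congrFun (congrFun (congrFun h₂ (toWords p)) o) a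

/-- Stated for a free morphism `a` instead of an algebra: its base then becomes a variable that
`subst` removes, and with it the cast in `vertical`. -/
theorem vertical_unit {A : Gph.{u}}
    (a : (⟨A.base, symGraph A.graph⟩ : Gph.{u}) ⟶ ⟨A.base, A.graph⟩) (ha : a.base = 𝟙 A.base)
    (h : symUnit A ≫ a = 𝟙 A) (p : Words A.base) (o : (A.base : Type u)ᵒᵖ)
    (x : (A.graph.obj p).obj o) :
    ((vertical a ha).app p).app o
      (Coend.mk (F := A.graph.flip.obj o) p x (𝟙 ((toSym _).obj p))) = x := by
  obtain ⟨U, a, a₁, a₂⟩ := a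
  dsimp only at ha
  subst ha
  have h' := eq_of_heq (Hom.ext_iff.mp h).2
  exact congrFun (congrFun (congrFun h' p) o) x

theorem vertical_assoc {A : Gph.{u}}
    (a : (⟨A.base, symGraph A.graph⟩ : Gph.{u}) ⟶ ⟨A.base, A.graph⟩) (ha : a.base = 𝟙 A.base)
    (h : symMul A ≫ a = symHom a ≫ a) {p q r : Words A.base} (o : (A.base : Type u)ᵒᵖ)
    (x : (A.graph.obj p).obj o) (s : (toSym A.base).obj p ⟶ (toSym A.base).obj q)
    (t : (toSym A.base).obj q ⟶ (toSym A.base).obj r) :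
    ((vertical a ha).app r).app o (Coend.mk (F := A.graph.flip.obj o) p x (s ≫ t)) =
      ((vertical a ha).app r).app o (Coend.mk (F := A.graph.flip.obj o) q
        (((vertical a ha).app q).app o (Coend.mk (F := A.graph.flip.obj o) p x s)) t) := by
  obtain ⟨U, a, a₁, a₂⟩ := a
  dsimp only at ha
  subst ha
  have h' := eq_of_heq (Hom.ext_iff.mp h).2
  exact congrFun (congrFun (congrFun h' r) o)
    (Coend.mk (F := (symGraph A.graph).flip.obj o) q
      (Coend.mk (F := A.graph.flip.obj o) p x s) t)

theorem app_eq_vertical {O : Cat.{u, u}} {A B : Words O ⥤ Psh O}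
    (f : (⟨O, A⟩ : Gph.{u}) ⟶ ⟨O, B⟩) (h : f.base = 𝟙 O) (p : Words O) (o : (O : Type u)ᵒᵖ)
    (x : (A.obj p).obj o) : HEq (f.app p o x) (((vertical f h).app p).app o x) :=
  (cast_heq _ _).symm

/-- The action of an algebra for the symmetrization monad on the class of `(x, s)`. -/
def act (A : symMonad.{u}.Algebra) {p q : Words A.A.base} (o : (A.A.base : Type u)ᵒᵖ)
    (s : (toSym A.A.base).obj p ⟶ (toSym A.A.base).obj q) (x : (A.A.graph.obj p).obj o) :
    (A.A.graph.obj q).obj o :=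
  ((action A).app q).app o (Coend.mk (F := A.A.graph.flip.obj o) p x s)

/-- The coend relation gives `[x, v] = [A(v)x, 1]` for `v` in `M(O)`, and the unit law evaluates the
right side. -/
theorem act_toSym (A : symMonad.{u}.Algebra) {p q : Words A.A.base} (o : (A.A.base : Type u)ᵒᵖ)
    (v : p ⟶ q) (x : (A.A.graph.obj p).obj o) :
    act A o ((toSym _).map v) x = (A.A.graph.map v).app o x := by
  refine Eq.trans ?_ (vertical_unit A.a (algebra_base A) A.unit q o ((A.A.graph.map v).app o x))
  refine congrArg (((action A).app q).app o) ?_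
  refine Eq.trans ?_ (Coend.condition (F := A.A.graph.flip.obj o) (G := homTo q) v x (𝟙 _)).symm
  exact congrArg (Coend.mk (F := A.A.graph.flip.obj o) (G := homTo q) p x)
    (Category.comp_id _).symm

theorem act_naturality (A : symMonad.{u}.Algebra) {p q : Words A.A.base}
    {o o' : (A.A.base : Type u)ᵒᵖ} (w : o ⟶ o')
    (s : (toSym A.A.base).obj p ⟶ (toSym A.A.base).obj q) (x : (A.A.graph.obj p).obj o) :
    act A o' s ((A.A.graph.obj p).map w x) = (A.A.graph.obj q).map w (act A o s x) :=
  NatTrans.naturality_apply ((action A).app q) w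
    (Coend.mk (F := A.A.graph.flip.obj o) p x s)

/-- The functor on `sM(O)` given by an algebra for the symmetrization monad. -/
def extend (A : symMonad.{u}.Algebra) : SymWords A.A.base ⥤ Psh A.A.base where
  obj p := A.A.graph.obj (toWords p)
  map {p q} s :=
    { app := fun o => ↾ act A (p := toWords p) (q := toWords q) o s
      naturality := fun o o' w => by
        ext x
        exact act_naturality A (p := toWords p) (q := toWords q) w s x }
  map_id p := by
    ext o x
    exact vertical_unit A.a (algebra_base A) A.unit (toWords p) o x
  map_comp {p q r} s t := by
    ext o x
    exact vertical_assoc A.a (algebra_base A) A.assoc (p := toWords p) (q := toWords q)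
      (r := toWords r) o x s t

/-- The identity maps from the restriction of `extend A` to `A`, as a morphism of graphs. -/
def extendHom (A : symMonad.{u}.Algebra) : ((restrict A.A.base).obj (extend A)).A ⟶ A.A where
  base := 𝟙 A.A.base
  app _ _ a := a
  natural_left _ _ _ _ _ := rfl
  natural_right {p q} v o a := by
    refine (act_toSym A o v a).trans ?_
    obtain ⟨v⟩ := v
    rfl

/-- The inverse of `extendHom`. -/
def extendInv (A : symMonad.{u}.Algebra) : A.A ⟶ ((restrict A.A.base).obj (extend A)).A where
  base := 𝟙 A.A.base
  app _ _ a := a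
  natural_left _ _ _ _ _ := rfl
  natural_right {p q} v o a := by
    refine (act_toSym A o v a).symm.trans ?_
    obtain ⟨v⟩ := v
    rfl

/-- The underlying graph of the restriction of `extend A` is isomorphic to that of `A`. -/
def extendGphIso (A : symMonad.{u}.Algebra) :
    ((restrict A.A.base).obj (extend A)).A ≅ A.A where
  hom := extendHom A
  inv := extendInv A

/-- The restriction of `extend A` is isomorphic to `A`. -/
def extendIso (A : symMonad.{u}.Algebra) : (restrict A.A.base).obj (extend A) ≅ A :=
  Monad.Algebra.isoMk (extendGphIso A)
    -- Both actions agree on `[a, s]` by construction; they are compared up to `HEq` because the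
    -- base of `A.a` is the identity only propositionally.
    (hom_ext' (𝟙 A.A.base) (algebra_base A) rfl fun q o y => by
      induction y using Coend.ind with
      | h p a s =>
        exact app_eq_vertical A.a (algebra_base A) q o
          (Coend.mk (F := A.A.graph.flip.obj o) p a s))

instance essSurj_restrictFiber : (restrictFiber O).EssSurj where
  mem_essImage := by
    rintro ⟨A, rfl⟩
    refine ⟨extend A, ⟨⟨⟨(extendIso A).hom, ?_⟩, ⟨(extendIso A).inv, ?_⟩, ?_, ?_⟩⟩⟩
    -- The isomorphism is vertical: both its components have base `𝟙` by definition.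
    · exact IsHomLift.map emProj (extendIso A).hom
    · exact IsHomLift.map emProj (extendIso A).inv
    · exact Subtype.ext (extendIso A).hom_inv_id
    · exact Subtype.ext (extendIso A).inv_hom_id

instance isEquivalence_restrictFiber : (restrictFiber O).IsEquivalence where

end Equivalence

end Gph

/-! ### Invariance of analyticity under isomorphisms of the base. -/

section KanTransport

open Functor

variable {C C' D D' H H' : Type*} [Category* C] [Category* C'] [Category* D] [Category* D']
  [Category* H] [Category* H']

/-- `R` preserves the extension, precomposition with `E` replaces `L` by `E ⋙ L`, and `e` lets the
equivalence `W` turn this into an extension along `L'`. -/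
theorem exists_isLeftKanExtension_transport (L : C ⥤ D) (L' : C' ⥤ D') (E : C' ⥤ C)
    [E.IsEquivalence] (W : D' ⥤ D) [W.IsEquivalence] (R : H ⥤ H') (e : L' ⋙ W ≅ E ⋙ L)
    {F : C ⥤ H} [R.PreservesLeftKanExtension F L] (T : D ⥤ H) (α : F ⟶ L ⋙ T)
    [T.IsLeftKanExtension α] :
    ∃ (G : C' ⥤ H') (β : G ⟶ L' ⋙ W ⋙ T ⋙ R), (W ⋙ T ⋙ R).IsLeftKanExtension β := by
  have h₁ := PreservesLeftKanExtension.preserves (G := R) T α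
  have h₂ := (isLeftKanExtension_iff_precomp _ E _).mp h₁
  exact ⟨_, _, (isLeftKanExtension_iff_postcomp₁ W e _).mp h₂⟩

end KanTransport

section Coproduct

open Limits

/-- `h` is the coproduct of the `c j` followed by `sigmaComparison`, which is invertible because `G`
preserves the coproduct. -/
theorem isIso_of_ι_comp_eq_comp_map_ι {C D : Type*} [Category* C] [Category* D] {J : Type*}
    (G : C ⥤ D) {f : J → C} {g : J → D} [HasCoproduct f] [HasCoproductsOfShape J D]
    [PreservesColimit (Discrete.functor f) G] (c : ∀ j, g j ⟶ G.obj (f j)) [∀ j, IsIso (c j)]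
    (h : ∐ g ⟶ G.obj (∐ f)) (w : ∀ j, Sigma.ι g j ≫ h = c j ≫ G.map (Sigma.ι f j)) :
    IsIso h := by
  have e : h = Limits.Sigma.map c ≫ sigmaComparison G f :=
    Sigma.hom_ext _ _ fun j => by
      rw [w, Sigma.ι_map_assoc, ι_comp_sigmaComparison]
  rw [e]
  infer_instance

end Coproduct

section SumComparison

variable {O Q : Type u} [Category.{u} O] [Category.{u} Q]

theorem isAnalytic_of_iso {P R : Psh O ⥤ Psh Q} (e : P ≅ R) (h : IsAnalytic P) :
    IsAnalytic R := by
  obtain ⟨F, α, hα⟩ := h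
  exact ⟨F, _, Functor.isLeftKanExtension_of_iso e α _ rfl⟩

/-- The comparison map between a sum of representables and the reindexing of the sum of their
images under a functor. -/
noncomputable def sumComparison (U : O ⥤ Q) :
    sumFunctor O ⟶ symWordsMap U ⋙ sumFunctor Q ⋙ pull U where
  app p := classify (X := (pull U).obj ((sumFunctor Q).obj ((symWordsMap U).obj p))) p
    -- The `i`-th entry of this family lies over `U (p i)`, so it is also an element of the
    -- reindexed presheaf at `p i`.
    (generic ((symWordsMap U).obj p))
  naturality p q s := by
    refine (map_classify s _).trans (Eq.trans ?_ (classify_comp p _ _).symm)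
    exact congrArg (classify p) (powerMap_map_generic ((symWordsMap U).map s)).symm

theorem sumι_sumComparison (U : O ⥤ Q) (p : SymWords O) (i : Fin p.len) :
    sumι p i ≫ (sumComparison U).app p =
      yonedaMap U (p.letter i) ≫ (pull U).map (sumι ((symWordsMap U).obj p) i) := by
  refine (sumι_classify p _ i).trans ?_
  apply yonedaEquiv.injective
  refine (Equiv.apply_symm_apply _ _).trans ?_
  exact congrArg ((sumι ((symWordsMap U).obj p) i).app _) (U.map_id _).symm

instance isIso_yonedaMap (U : O ⥤ Q) [U.Full] [U.Faithful] (o : O) : IsIso (yonedaMap U o) := by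
  have : ∀ o', IsIso ((yonedaMap U o).app o') := fun o' => by
    rw [isIso_iff_bijective]
    exact ⟨fun _ _ h => U.map_injective h, fun f => U.map_surjective f⟩
  exact NatIso.isIso_of_isIso_app _

instance isIso_sumComparison (U : O ⥤ Q) [U.Full] [U.Faithful] : IsIso (sumComparison U) := by
  have : ∀ p, IsIso ((sumComparison U).app p) := fun p =>
    isIso_of_ι_comp_eq_comp_map_ι (pull U) (fun i => yonedaMap U (p.letter i)) _
      (sumι_sumComparison U p)
  exact NatIso.isIso_of_isIso_app _

end SumComparison

section Reindexing

/-- An isomorphism in `Cat` has strictly inverse functors, and `symWordsMap` respects composites and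
identities on the nose. -/
theorem symWordsMap_isEquivalence {O Q : Cat.{u, u}} (e : O ≅ Q) :
    (symWordsMap e.hom.toFunctor).IsEquivalence := by
  have h₁ : symWordsMap e.hom.toFunctor ⋙ symWordsMap e.inv.toFunctor = 𝟭 _ :=
    congrArg (fun U : O ⟶ O => symWordsMap U.toFunctor) e.hom_inv_id
  have h₂ : symWordsMap e.inv.toFunctor ⋙ symWordsMap e.hom.toFunctor = 𝟭 _ :=
    congrArg (fun U : Q ⟶ Q => symWordsMap U.toFunctor) e.inv_hom_id
  exact (CategoryTheory.Equivalence.mk _ _ (eqToIso h₁.symm) (eqToIso h₂)).isEquivalence_functor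

theorem isEquivalence_toFunctor {O Q : Cat.{u, u}} (e : O ≅ Q) :
    e.hom.toFunctor.IsEquivalence :=
  (Cat.equivOfIso e).isEquivalence_functor

/-- The sum functors of isomorphic categories correspond under reindexing. -/
noncomputable def sumReindexIso {O Q : Cat.{u, u}} (e : O ≅ Q) :
    sumFunctor Q ⋙ pull e.hom.toFunctor ≅ symWordsMap e.inv.toFunctor ⋙ sumFunctor O :=
  have := isEquivalence_toFunctor e
  have h : symWordsMap e.inv.toFunctor ⋙ symWordsMap e.hom.toFunctor = 𝟭 _ :=
    congrArg (fun U : Q ⟶ Q => symWordsMap U.toFunctor) e.inv_hom_id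
  (Functor.leftUnitor _).symm ≪≫
    Functor.isoWhiskerRight (eqToIso h.symm) (sumFunctor Q ⋙ pull e.hom.toFunctor) ≪≫
    Functor.associator _ _ _ ≪≫
    Functor.isoWhiskerLeft (symWordsMap e.inv.toFunctor)
      (asIso (sumComparison e.hom.toFunctor)).symm

theorem isAnalytic_reindex {O Q : Cat.{u, u}} (e : O ≅ Q) {T : Psh O ⥤ Psh O}
    (h : IsAnalytic T) : IsAnalytic (pull e.hom.toFunctor ⋙ T ⋙ pull e.inv.toFunctor) := by
  obtain ⟨F, α, hα⟩ := h
  have := isEquivalence_toFunctor e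
  have : (symWordsMap e.inv.toFunctor).IsEquivalence := symWordsMap_isEquivalence e.symm
  exact exists_isLeftKanExtension_transport (sumFunctor O) (sumFunctor Q)
    (symWordsMap e.inv.toFunctor) (pull e.hom.toFunctor) (pull e.inv.toFunctor)
    (sumReindexIso e) T α

end Reindexing

/-! ### Isomorphisms in the fibration of endofunctors. -/

namespace EndPsh

theorem isIso_trans_app_of_eq_id {P : EndPsh.{u}} {f : P ⟶ P} (h : f = 𝟙 P) (X : Psh P.base) :
    IsIso (f.trans.app X) := by
  subst h
  exact inferInstanceAs (IsIso (𝟙 (P.functor.obj X)))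

/-- Presheaf categories are balanced, so mono and epi suffice. One inverse law makes the component
mono on objects reindexed along `e.inv`, which are all objects up to isomorphism. The other makes
its reindexing epi, and reindexing along an equivalence reflects epimorphisms. -/
theorem isIso_trans {P R : EndPsh.{u}} (e : P ≅ R) : IsIso e.hom.trans := by
  let b : P.base ≅ R.base := proj.mapIso e
  have : e.inv.base.toFunctor.IsEquivalence := isEquivalence_toFunctor b.symm
  have hmono : ∀ X, Mono (e.hom.trans.app X) := fun X => by
    let Y := (pull e.inv.base.toFunctor).objPreimage X
    let i : (pull e.inv.base.toFunctor).obj Y ≅ X := (pull e.inv.base.toFunctor).objObjPreimageIso X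
    have h : IsIso (e.hom.trans.app ((pull e.inv.base.toFunctor).obj Y) ≫
        (pull e.hom.base.toFunctor).map (e.inv.trans.app Y)) :=
      isIso_trans_app_of_eq_id e.hom_inv_id Y
    have : Mono (e.hom.trans.app ((pull e.inv.base.toFunctor).obj Y)) := mono_of_mono _
      ((pull e.hom.base.toFunctor).map (e.inv.trans.app Y))
    exact ((MorphismProperty.monomorphisms _).arrow_mk_iso_iff
      (Arrow.isoMk (((pull e.hom.base.toFunctor) ⋙ P.functor).mapIso i)
        ((R.functor ⋙ pull e.hom.base.toFunctor).mapIso i)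
        (e.hom.trans.naturality i.hom))).mp this
  have hepi : ∀ X, Epi (e.hom.trans.app X) := fun X => by
    have h : IsIso (e.inv.trans.app ((pull e.hom.base.toFunctor).obj X) ≫
        (pull e.inv.base.toFunctor).map (e.hom.trans.app X)) :=
      isIso_trans_app_of_eq_id e.inv_hom_id X
    have : Epi ((pull e.inv.base.toFunctor).map (e.hom.trans.app X)) :=
      epi_of_epi (e.inv.trans.app ((pull e.hom.base.toFunctor).obj X)) _
    exact (pull e.inv.base.toFunctor).epi_of_epi_map this
  have : ∀ X, IsIso (e.hom.trans.app X) := fun X => by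
    have := hmono X
    have := hepi X
    exact isIso_of_mono_of_epi _
  exact NatIso.isIso_of_isIso_app _

/-- Isomorphic endofunctors over an isomorphism of base categories are conjugate. -/
noncomputable def conjIso {P R : EndPsh.{u}} (e : P ≅ R) :
    pull e.hom.base.toFunctor ⋙ P.functor ⋙ pull e.inv.base.toFunctor ≅ R.functor :=
  have := isIso_trans e
  have h : pull e.hom.base.toFunctor ⋙ pull e.inv.base.toFunctor = 𝟭 _ :=
    congrArg (fun U : R.base ⟶ R.base => pull U.toFunctor) (proj.mapIso e).inv_hom_id
  Functor.isoWhiskerRight (asIso e.hom.trans) (pull e.inv.base.toFunctor) ≪≫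
    Functor.isoWhiskerLeft R.functor (eqToIso h)

theorem isAnalytic_of_iso {P R : EndPsh.{u}} (e : P ≅ R) (h : IsAnalytic P.functor) :
    IsAnalytic R.functor :=
  Symmetrization.isAnalytic_of_iso (conjIso e) (isAnalytic_reindex (proj.mapIso e) h)

end EndPsh

/-! ### The essential image of the representation. -/

namespace Gph

theorem isAnalytic_emRep (A : symMonad.{u}.Algebra) : IsAnalytic (emRep.obj A).functor :=
  EndPsh.isAnalytic_of_iso (emRep.mapIso (extendIso A))
    ⟨extend A, kanUnit (extend A), isLeftKanExtension_kanUnit _⟩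

theorem essImage_emRep_iff (P : EndPsh.{u}) : emRep.essImage P ↔ IsAnalytic P.functor := by
  constructor
  · rintro ⟨A, ⟨e⟩⟩
    exact EndPsh.isAnalytic_of_iso e (isAnalytic_emRep A)
  · obtain ⟨O, P⟩ := P
    rintro ⟨F, α, hα⟩
    have : ((analyticRep O).obj F).IsLeftKanExtension (kanUnit F) := isLeftKanExtension_kanUnit F
    -- Left Kan extensions of `F` are unique up to isomorphism, so `P` is vertically isomorphic to
    -- the endofunctor represented by the restriction of `F`.
    exact ⟨restrictAlgebra F, ⟨(EndPsh.incl O).mapIso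
      (Functor.leftKanExtensionUnique ((analyticRep O).obj F) (kanUnit F) P α)⟩⟩

end Gph

end Symmetrization

theorem mainTheorem10 :
    (∀ O : CategoryTheory.Cat.{u, u},
      (Symmetrization.Gph.restrictFiber O).IsEquivalence ∧
      Nonempty (Symmetrization.Gph.restrictFiber O ⋙ Symmetrization.Gph.emRepFiber O ≅
        (Symmetrization.sumFunctor O).lan ⋙ Symmetrization.EndPsh.toFiber O)) ∧
    (∀ P : Symmetrization.EndPsh.{u},
      Symmetrization.Gph.emRep.essImage P ↔ Symmetrization.IsAnalytic P.functor) :=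
  ⟨fun _ => ⟨Symmetrization.Gph.isEquivalence_restrictFiber,
    ⟨Symmetrization.Gph.restrictFiberRepIso ≪≫
      Functor.isoWhiskerRight Symmetrization.Gph.analyticRepIsoLan _⟩⟩,
    Symmetrization.Gph.essImage_emRep_iff⟩
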